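/- All spaces are Tychonoff. A *$P$-space* is a space in which every $G_\delta$-subset is open. A continuous map $f:X\to Y$ is *skeletal* if $\operatorname{Int}\overline{f(U)}\neq\varnothing$ for every nonempty open $U\subset X$. A space $X$ is *skeletally Dugundji* if there are a cardinal $\tau>0$ (identified with its initial ordinal) and a well-ordered inverse system $S=\{X_\alpha,p^\beta_\alpha,\alpha<\beta<\tau\}$ of spaces with surjective skeletal bonding maps $p^\beta_\alpha:X_\beta\to X_\alpha$ such that: (i) $X_0$ is separable metrizable, and for every $\alpha$ with $\alpha+1<\tau$ the map $p^{\alpha+1}_\alpha$ has a metrizable kernel, i.e. there are a separable metrizable space $M_\alpha$ and an embedding of $X_{\alpha+1}$ in $X_\alpha\times M_\alpha$ under which $p^{\alpha+1}_\alpha$ is the restriction of the projection $X_\alpha\times M_\alpha\to X_\alpha$; (ii) for every limit ordinal $\gamma<\tau$ the canonical map (given by the $p^\gamma_\alpha$) embeds $X_\gamma$ as a dense subspace of $\varprojlim\{X_\alpha,p^\beta_\alpha,\alpha<\beta<\gamma\}$; (iii) $X$ is embedded in $\varprojlim S$ so that $p_\alpha(X)=X_\alpha$ for every $\alpha<\tau$,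 where $p_\alpha:\varprojlim S\to X_\alpha$ is the limit projection; (iv) for every bounded continuous $f:\varprojlim S\to\mathbb R$ there are $\alpha<\tau$ and a continuous $g:X_\alpha\to\mathbb R$ with $f=g\circ p_\alpha$. **Lemma 2.5.** Every skeletally Dugundji $P$-space is discrete. -/

import Mathlib

open Set Topology

universe u v w

/-- A `P`-space: every `G_δ`-subset is open. -/
def IsPSpace (X : Type u) [TopologicalSpace X] : Prop :=
  ∀ s : Set X, IsGδ s → IsOpen s

/-- A continuous map is skeletal if the closure of the image of every nonempty open set has
nonempty interior. -/
def IsSkeletal {Y Z : Type w} [TopologicalSpace Y] [TopologicalSpace Z] (f : Y → Z) : Prop :=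
  Continuous f ∧ ∀ U : Set Y, IsOpen U → U.Nonempty → (interior (closure (f '' U))).Nonempty

/-- `f : Y → Z` has a metrizable kernel: for some separable metrizable space `M`, `Y` embeds in
`Z × M` in such a way that `f` becomes the restriction of the projection `Z × M → Z`. -/
def HasMetrizableKernel {Y Z : Type w} [TopologicalSpace Y] [TopologicalSpace Z]
    (f : Y → Z) : Prop :=
  ∃ (M : Type w) (_ : TopologicalSpace M),
    TopologicalSpace.SeparableSpace M ∧ TopologicalSpace.MetrizableSpace M ∧
      ∃ e : Y → Z × M, IsEmbedding e ∧ ∀ y, (e y).1 = f y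

/-- The limit of an inverse system `p` of sets, as a subset of the product (with the subspace
topology of the product topology, when the `F i` are spaces). -/
def inverseLimit {ι : Type*} [Preorder ι] (F : ι → Type w)
    (p : ∀ ⦃i j : ι⦄, i ≤ j → F j → F i) : Set (∀ i, F i) :=
  {x | ∀ ⦃i j : ι⦄ (h : i ≤ j), p h (x j) = x i}

/-- A well ordered inverse system of Tychonoff spaces and continuous maps, indexed by the ordinals
`α < τ`, where the cardinal `τ` is identified with its initial ordinal. -/
structure WellOrderedInverseSystem (τ : Cardinal.{v}) where
  space : Iio τ.ord → Type w
  [top : ∀ α, TopologicalSpace (space α)]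
  [tychonoff : ∀ α, T35Space (space α)]
  bond : ∀ ⦃α β : Iio τ.ord⦄, α ≤ β → space β → space α
  continuous_bond : ∀ ⦃α β : Iio τ.ord⦄ (h : α ≤ β), Continuous (bond h)
  bond_self : ∀ (α : Iio τ.ord) (x : space α), bond (le_refl α) x = x
  bond_bond : ∀ ⦃α β γ : Iio τ.ord⦄ (h : α ≤ β) (h' : β ≤ γ) (x : space γ),
    bond h (bond h' x) = bond (h.trans h') x

namespace WellOrderedInverseSystem

attribute [instance] top tychonoff

variable {τ : Cardinal.{v}} (S : WellOrderedInverseSystem.{v, w} τ)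

/-- The limit of the whole system. -/
abbrev lim : Set (∀ α, S.space α) := inverseLimit S.space S.bond

/-- The limit projection to the `α`-th space. -/
def proj (α : Iio τ.ord) (x : S.lim) : S.space α := x.1 α

/-- The limit of the system restricted to the indices below `γ`. -/
abbrev limBelow (γ : Iio τ.ord) : Set (∀ α : Iio γ, S.space α.1) :=
  inverseLimit (fun α : Iio γ => S.space α.1) (fun _ _ h => S.bond h)

/-- The canonical map from the `γ`-th space to the limit of the system below `γ`. -/
def toLimBelow (γ : Iio τ.ord) (x : S.space γ) : S.limBelow γ :=
  ⟨fun α => S.bond (le_of_lt α.2) x, fun _ _ h => S.bond_bond h _ x⟩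

/-- The initial space is separable metrizable and the maps between successive spaces have
metrizable kernels. -/
def HasMetrizableSteps : Prop :=
  (∃ h : (0 : Ordinal.{v}) < τ.ord,
    TopologicalSpace.SeparableSpace (S.space ⟨0, h⟩) ∧
      TopologicalSpace.MetrizableSpace (S.space ⟨0, h⟩)) ∧
  ∀ (α β : Iio τ.ord) (h : α ≤ β), β.1 = Order.succ α.1 → HasMetrizableKernel (S.bond h)

/-- At every limit ordinal `γ < τ`, the `γ`-th space is, via the bonding maps, a dense subspace of
the limit of the system below `γ`. -/
def IsAlmostContinuous : Prop :=
  ∀ γ : Iio τ.ord, Order.IsSuccLimit γ.1 → IsDenseEmbedding (S.toLimBelow γ)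

/-- `X` embeds in the limit of the system with every limit projection mapping it onto the
corresponding space. -/
def IsAlmostLimit (X : Type u) [TopologicalSpace X] : Prop :=
  ∃ e : X → S.lim, IsEmbedding e ∧ ∀ α, Function.Surjective fun x => S.proj α (e x)

/-- Every bounded continuous real function on the limit factors continuously through a limit
projection. -/
def IsFactorizing : Prop :=
  ∀ f : BoundedContinuousFunction S.lim ℝ, ∃ (α : Iio τ.ord) (g : C(S.space α, ℝ)),
    ∀ x, f x = g (S.proj α x)

end WellOrderedInverseSystem

/-- Skeletally Dugundji spaces. The universe `v` of the length of the system and the universe `w`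
of its spaces are arbitrary. -/
def IsSkeletallyDugundji (X : Type u) [TopologicalSpace X] : Prop :=
  ∃ (τ : Cardinal.{v}) (S : WellOrderedInverseSystem.{v, w} τ),
    (∀ ⦃α β : Iio τ.ord⦄ (h : α ≤ β),
      Function.Surjective (S.bond h) ∧ IsSkeletal (S.bond h)) ∧
    S.HasMetrizableSteps ∧ S.IsAlmostContinuous ∧ S.IsAlmostLimit X ∧ S.IsFactorizing

open MeasureTheory

/-! A Hausdorff `P`-space of countable cellularity is discrete, so it suffices to show that
skeletally Dugundji spaces have countable cellularity.

Metrizable kernels supply countably many open sets at each successor step. Well-founded descent then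
describes a nonempty open set by finitely many natural numbers placed at ordinals: skeletality
replaces an image by the interior of its closure, and limit stages drop to an earlier space
(`exists_box_codes`). Sets described by one sequence meet in a common space (`Codes.exists_mem`).
Hence disjoint open sets have disjoint sets of codes, each containing a finite box, and a product
probability allows only countably many of these. -/

/-- Every disjoint family of nonempty open sets is countable. -/
def HasCountableCellularity (X : Type*) [TopologicalSpace X] : Prop :=
  ∀ 𝒰 : Set (Set X), (∀ U ∈ 𝒰, IsOpen U ∧ U.Nonempty) → 𝒰.PairwiseDisjoint id → 𝒰.Countable

/-! ### Countable cellularity and discreteness -/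

/-- A Hausdorff `P`-space of countable cellularity is discrete. -/
theorem IsPSpace.discreteTopology {X : Type u} [TopologicalSpace X] [T2Space X]
    (hP : IsPSpace X) (hc : HasCountableCellularity X) : DiscreteTopology X := by
  refine discreteTopology_iff_isOpen_singleton.2 fun x => ?_
  by_contra hx
  obtain ⟨𝒰, hmax⟩ := zorn_subset
    {𝒰 : Set (Set X) | (∀ U ∈ 𝒰, IsOpen U ∧ U.Nonempty ∧ x ∉ closure U) ∧ 𝒰.PairwiseDisjoint id}
    (by
      refine fun c hc hchain => ⟨⋃₀ c, ⟨?_, ?_⟩, fun s hs => subset_sUnion_of_mem hs⟩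
      · rintro U ⟨s, hs, hU⟩
        exact (hc hs).1 U hU
      · exact (pairwiseDisjoint_sUnion hchain.directedOn).2 fun s hs => (hc hs).2)
  obtain ⟨h𝒰, hdisj⟩ := hmax.prop
  have hcount : 𝒰.Countable := hc 𝒰 (fun U hU => ⟨(h𝒰 U hU).1, (h𝒰 U hU).2.1⟩) hdisj
  set W : Set X := ⋂ U ∈ 𝒰, (closure U)ᶜ with hW
  have hWo : IsOpen W :=
    hP W (IsGδ.biInter_of_isOpen hcount fun U _ => isClosed_closure.isOpen_compl)
  have hxW : x ∈ W := mem_iInter₂.2 fun U hU => (h𝒰 U hU).2.2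
  -- A part of `W` near `y` and away from `x` could be added to the maximal family, although `W`
  -- misses all its members.
  obtain ⟨y, hyW, hyx⟩ : ∃ y ∈ W, y ≠ x := by
    by_contra! h
    exact hx ((eq_singleton_iff_unique_mem.2 ⟨hxW, h⟩ : W = {x}) ▸ hWo)
  obtain ⟨V, N, hV, hN, hyV, hxN, hVN⟩ := t2_separation hyx
  have hxV : x ∉ closure (V ∩ W) := fun h =>
    (hVN.mono_left inter_subset_left).closure_left hN |>.le_bot ⟨h, hxN⟩
  have hVU : ∀ U ∈ 𝒰, Disjoint (V ∩ W) U := fun U hU =>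
    disjoint_left.2 fun z hz hzU => mem_iInter₂.1 hz.2 U hU (subset_closure hzU)
  have hmem : V ∩ W ∈ 𝒰 := by
    refine hmax.le_of_ge (y := insert (V ∩ W) 𝒰) ⟨?_, ?_⟩ (subset_insert _ _) (mem_insert _ _)
    · rintro U (rfl | hU)
      · exact ⟨hV.inter hWo, ⟨y, hyV, hyW⟩, hxV⟩
      · exact h𝒰 U hU
    · exact hdisj.insert fun U hU _ => hVU U hU
  exact mem_iInter₂.1 hyW _ hmem (subset_closure ⟨hyV, hyW⟩)

/-! ### Bases, skeletal maps and boxes -/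

/-- In an inverse limit over a directed set, the preimages of open sets under the limit projections
form a base. -/
theorem exists_preimage_subset_of_isInducing {ι : Type*} [Preorder ι] [Nonempty ι]
    [IsDirectedOrder ι] {F : ι → Type w} [∀ i, TopologicalSpace (F i)]
    {p : ∀ ⦃i j : ι⦄, i ≤ j → F j → F i} (hp : ∀ ⦃i j : ι⦄ (h : i ≤ j), Continuous (p h))
    {Y : Type*} [TopologicalSpace Y] {g : Y → inverseLimit F p} (hg : IsInducing g)
    {U : Set Y} (hU : IsOpen U) {y : Y} (hy : y ∈ U) :
    ∃ i, ∃ V : Set (F i), IsOpen V ∧ (g y).1 i ∈ V ∧ ∀ z, (g z).1 i ∈ V → z ∈ U := by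
  obtain ⟨O, hO, rfl⟩ := (IsInducing.subtypeVal.comp hg).isOpen_iff.1 hU
  obtain ⟨s, v, hv, hsub⟩ := isOpen_pi_iff.1 hO _ hy
  obtain ⟨i, hi⟩ := s.exists_le
  refine ⟨i, ⋂ j : s, p (hi j j.2) ⁻¹' v j,
    isOpen_iInter_of_finite fun j => (hv j j.2).1.preimage (hp _), ?_, fun z hz => hsub ?_⟩
  · refine mem_iInter.2 fun j => ?_
    rw [mem_preimage, (g y).2]
    exact (hv j j.2).2
  · intro j hj
    have := mem_iInter.1 hz ⟨j, hj⟩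
    rwa [mem_preimage, (g z).2] at this

/-- A sequence of open sets whose intersections with the preimages of open sets under `f` form a
base. -/
def IsBaseOver {Y Z : Type*} [TopologicalSpace Y] [TopologicalSpace Z] (f : Y → Z)
    (O : ℕ → Set Y) : Prop :=
  (∀ n, IsOpen (O n)) ∧ ∀ U : Set Y, IsOpen U → ∀ y ∈ U,
    ∃ n, ∃ A : Set Z, IsOpen A ∧ f y ∈ A ∧ y ∈ O n ∧ f ⁻¹' A ∩ O n ⊆ U

theorem exists_seq_isTopologicalBasis (M : Type*) [TopologicalSpace M]
    [SecondCountableTopology M] :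
    ∃ B : ℕ → Set M, TopologicalSpace.IsTopologicalBasis (range B) := by
  obtain ⟨b, hb, -, hbasis⟩ := TopologicalSpace.exists_countable_basis M
  -- Adding `∅` makes the base nonempty, so that it is the range of a sequence even when `M` is
  -- empty.
  have hb' : (insert ∅ b).Countable := hb.insert _
  obtain ⟨B, hB⟩ := hb'.exists_eq_range (insert_nonempty _ _)
  exact ⟨B, hB ▸ hbasis.insert_empty⟩

theorem secondCountableTopology_of_separable_metrizable (M : Type*) [TopologicalSpace M]
    [TopologicalSpace.SeparableSpace M] [TopologicalSpace.MetrizableSpace M] :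
    SecondCountableTopology M := by
  let := TopologicalSpace.metrizableSpaceMetric M
  exact UniformSpace.secondCountable_of_separable M

theorem HasMetrizableKernel.exists_isBaseOver {Y Z : Type w} [TopologicalSpace Y]
    [TopologicalSpace Z] {f : Y → Z} (hf : HasMetrizableKernel f) :
    ∃ O : ℕ → Set Y, IsBaseOver f O := by
  obtain ⟨M, _, _, _, e, he, hef⟩ := hf
  have := secondCountableTopology_of_separable_metrizable M
  obtain ⟨B, hB⟩ := exists_seq_isTopologicalBasis M
  refine ⟨fun n => (fun y => (e y).2) ⁻¹' B n,
    fun n => (hB.isOpen ⟨n, rfl⟩).preimage (continuous_snd.comp he.continuous), fun U hU y hy => ?_⟩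
  obtain ⟨O, hO, rfl⟩ := he.isOpen_iff.1 hU
  obtain ⟨A, C, hA, hC, hyA, hyC, hAC⟩ := isOpen_prod_iff.1 hO (e y).1 (e y).2 hy
  obtain ⟨_, ⟨n, rfl⟩, hyn, hnC⟩ := hB.exists_subset_of_mem_open hyC hC
  refine ⟨n, A, hA, hef y ▸ hyA, hyn, fun z hz => hAC ⟨?_, hnC hz.2⟩⟩
  rw [hef z]
  exact hz.1

/-- If `f` is skeletal and `f ⁻¹' A ∩ O` is nonempty, then its image is somewhere dense in `A`. -/
theorem IsSkeletal.nonempty_inter_interior {Y Z : Type w} [TopologicalSpace Y]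
    [TopologicalSpace Z] {f : Y → Z} (hf : IsSkeletal f) {A : Set Z} {O : Set Y} (hA : IsOpen A)
    (hO : IsOpen O) (hne : (f ⁻¹' A ∩ O).Nonempty) :
    (A ∩ interior (closure (f '' (f ⁻¹' A ∩ O)))).Nonempty := by
  obtain ⟨z, hz⟩ := hf.2 _ ((hA.preimage hf.1).inter hO) hne
  obtain ⟨_, hx, y, hy, rfl⟩ :=
    mem_closure_iff.1 (interior_subset hz) _ isOpen_interior hz
  exact ⟨f y, hy.1, hx⟩

/-- A disjoint family of subsets of `I → ℕ`, each of which contains a basic open box, is countable,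
as every box has positive measure for the product of Poisson measures. -/
theorem countable_of_disjoint_boxes {ι I : Type*} (R : ι → Set (I → ℕ))
    (hbox : ∀ a, ∃ (s : Finset I) (t₀ : I → ℕ), ∀ t, (∀ i ∈ s, t i = t₀ i) → t ∈ R a)
    (hdisj : Pairwise (Function.onFun Disjoint R)) : Countable ι := by
  choose s t₀ hR using hbox
  let μ : Measure (I → ℕ) := Measure.infinitePi fun _ => ProbabilityTheory.poissonMeasure 1
  let C : ι → Set (I → ℕ) := fun a => Set.pi (s a) fun i => {t₀ a i}
  have hCR : ∀ a, C a ⊆ R a := fun a t ht => hR a t fun i hi => ht i hi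
  have hpos : ∀ a, 0 < μ (C a) := by
    intro a
    simp only [μ, C]
    rw [Measure.infinitePi_pi _ fun i _ => measurableSet_singleton _, pos_iff_ne_zero,
      Finset.prod_ne_zero_iff]
    intro i _ h0
    have h := ProbabilityTheory.poissonMeasure_real_singleton_pos (r := 1) (t₀ a i) one_pos
    rw [measureReal_def, h0] at h
    simp at h
  have hcount := Measure.countable_meas_pos_of_disjoint_iUnion (μ := μ) (As := C)
    (fun a => MeasurableSet.pi (s a).countable_toSet fun i _ => measurableSet_singleton _)
    (fun a b hab => (hdisj hab).mono (hCR a) (hCR b))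
  simpa [hpos, countable_univ_iff] using hcount

/-! ### Coding open sets by sequences -/

namespace WellOrderedInverseSystem

variable {τ : Cardinal.{v}} (S : WellOrderedInverseSystem.{v, w} τ)

/-- `S.Codes O t α U` says that the sequence `t` of indices of members of the families `O` describes
a nonempty part of the open set `U` of the `α`-th space: at `0` and at successors one uses the
member of the family with the prescribed index, at limits one passes to an earlier space. -/
inductive Codes (O : ∀ α, ℕ → Set (S.space α)) (t : Iio τ.ord → ℕ) :
    ∀ α : Iio τ.ord, Set (S.space α) → Prop
  | zero (α : Iio τ.ord) (U : Set (S.space α)) (h0 : α.1 = 0) (hne : (O α (t α)).Nonempty)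
      (hsub : O α (t α) ⊆ U) : Codes O t α U
  | succ (δ α : Iio τ.ord) (hδ : δ ≤ α) (hs : α.1 = Order.succ δ.1) (U : Set (S.space α))
      (A V : Set (S.space δ)) (hA : IsOpen A) (hVo : IsOpen V) (hVA : V ⊆ A)
      (hV : V ⊆ closure (S.bond hδ '' (S.bond hδ ⁻¹' A ∩ O α (t α))))
      (hsub : S.bond hδ ⁻¹' A ∩ O α (t α) ⊆ U) (hc : Codes O t δ V) : Codes O t α U
  | limit (δ α : Iio τ.ord) (hδ : δ < α) (hl : Order.IsSuccLimit α.1) (U : Set (S.space α))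
      (V : Set (S.space δ)) (hVo : IsOpen V) (hsub : S.bond hδ.le ⁻¹' V ⊆ U)
      (hc : Codes O t δ V) : Codes O t α U

variable {S}

/-- Open sets described by the same sequence meet, after being pulled back to a common space. -/
theorem Codes.exists_mem (hsurj : ∀ ⦃α β : Iio τ.ord⦄ (h : α ≤ β), Function.Surjective (S.bond h))
    {O : ∀ α, ℕ → Set (S.space α)} {t : Iio τ.ord → ℕ} (γ : Iio τ.ord) :
    ∀ (α β : Iio τ.ord) (hα : α ≤ γ) (hβ : β ≤ γ) (U : Set (S.space α)) (V : Set (S.space β)),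
      IsOpen U → IsOpen V → S.Codes O t α U → S.Codes O t β V →
      ∃ x : S.space γ, S.bond hα x ∈ U ∧ S.bond hβ x ∈ V := by
  induction γ using WellFoundedLT.induction with
  | ind γ IH =>
  have lift : ∀ (α β : Iio τ.ord) (hα : α < γ) (hβ : β < γ) (U : Set (S.space α))
      (V : Set (S.space β)), IsOpen U → IsOpen V → S.Codes O t α U → S.Codes O t β V →
      ∃ x : S.space γ, S.bond hα.le x ∈ U ∧ S.bond hβ.le x ∈ V := by
    intro α β hα hβ U V hU hV hcU hcV
    have hlt : max α β < γ := max_lt hα hβ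
    obtain ⟨x, hxU, hxV⟩ := IH _ hlt α β (le_max_left _ _) (le_max_right _ _) U V hU hV hcU hcV
    obtain ⟨y, rfl⟩ := hsurj hlt.le x
    rw [S.bond_bond] at hxU hxV
    exact ⟨y, hxU, hxV⟩
  have mixed : ∀ (α : Iio τ.ord) (hα : α < γ) (U : Set (S.space α)) (V : Set (S.space γ)),
      IsOpen U → S.Codes O t α U → S.Codes O t γ V →
      ∃ x : S.space γ, S.bond hα.le x ∈ U ∧ x ∈ V := by
    intro α hα U V hU hcU hcV
    cases hcV with
    | zero _ _ h0 _ _ =>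
      have h : α.1 < γ.1 := hα
      rw [h0] at h
      exact absurd h not_lt_zero
    | succ δ _ hδ hs _ A V' hA hVo hVA hV hsub hc =>
      have hδγ : δ < γ := Subtype.coe_lt_coe.1 (hs ▸ Order.lt_succ δ.1)
      have hαδ : α ≤ δ := by
        have h : α.1 < γ.1 := hα
        rw [hs] at h
        exact Subtype.coe_le_coe.1 (Order.lt_succ_iff.1 h)
      obtain ⟨x, hxU, hxV⟩ := IH δ hδγ α δ hαδ le_rfl U V' hU hVo hcU hc
      rw [S.bond_self] at hxV
      -- The pullback of `U` to `δ` is a neighbourhood of a point in the closure of the image, so it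
      -- meets the image itself.
      obtain ⟨_, hzU, y, hy, rfl⟩ := mem_closure_iff.1 (hV hxV) _
        (hU.preimage (S.continuous_bond hαδ)) hxU
      rw [mem_preimage, S.bond_bond] at hzU
      exact ⟨y, hzU, hsub hy⟩
    | limit δ _ hδ hl _ V' hVo hsub hc =>
      obtain ⟨x, hxU, hxV⟩ := lift α δ hα hδ U V' hU hVo hcU hc
      exact ⟨x, hxU, hsub hxV⟩
  intro α β hα hβ U V hU hV hcU hcV
  rcases hα.lt_or_eq with hα' | rfl
  · rcases hβ.lt_or_eq with hβ' | rfl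
    · exact lift α β hα' hβ' U V hU hV hcU hcV
    · obtain ⟨x, hxU, hxV⟩ := mixed α hα' U V hU hcU hcV
      exact ⟨x, hxU, by rwa [S.bond_self]⟩
  rcases hβ.lt_or_eq with hβ' | rfl
  · obtain ⟨x, hxV, hxU⟩ := mixed β hβ' V U hV hcV hcU
    exact ⟨x, by rwa [S.bond_self], hxV⟩
  simp only [S.bond_self]
  cases hcU with
  | zero _ _ h0 hne hsub =>
    cases hcV with
    | zero _ _ _ _ hsub' => exact hne.imp fun x hx => ⟨hsub hx, hsub' hx⟩
    | succ δ _ hδ hs => exact absurd (hs.symm.trans h0) (Order.succ_ne_bot δ.1)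
    | limit δ _ hδ hl => exact absurd h0 hl.ne_bot
  | succ δ _ hδ hs _ A V₁ hA hVo hVA hV₁ hsub hc =>
    cases hcV with
    | zero _ _ h0 => exact absurd (hs.symm.trans h0) (Order.succ_ne_bot δ.1)
    | succ δ' _ hδ' hs' _ A' V₂ hA' hVo' hVA' hV₂ hsub' hc' =>
      obtain rfl : δ = δ' := Subtype.ext (Order.succ_injective (hs.symm.trans hs'))
      have hδβ : δ < β := Subtype.coe_lt_coe.1 (hs ▸ Order.lt_succ δ.1)
      obtain ⟨x, hx, hx'⟩ := IH δ hδβ δ δ le_rfl le_rfl V₁ V₂ hVo hVo' hc hc'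
      rw [S.bond_self] at hx hx'
      -- Both codes use the same member `O β (t β)`. A point of it lying over `A ∩ V₂` therefore
      -- serves both sets, since `V₂ ⊆ A'`.
      obtain ⟨_, hz, y, hy, rfl⟩ := mem_closure_iff.1 (hV₁ hx) _ hVo' hx'
      exact ⟨y, hsub hy, hsub' ⟨hVA' hz, hy.2⟩⟩
    | limit _ _ _ hl => exact absurd hl (hs ▸ Order.not_isSuccLimit_succ δ.1)
  | limit δ _ hδ hl _ V₁ hVo hsub hc =>
    cases hcV with
    | zero _ _ h0 => exact absurd h0 hl.ne_bot
    | succ δ' _ _ hs => exact absurd hl (hs ▸ Order.not_isSuccLimit_succ δ'.1)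
    | limit δ' _ hδ' _ _ V₂ hVo' hsub' hc' =>
      obtain ⟨x, hx, hx'⟩ := lift δ δ' hδ hδ' V₁ V₂ hVo hVo' hc hc'
      exact ⟨x, hsub hx, hsub' hx'⟩

/-- Every nonempty open set is described by all sequences in some box. -/
theorem exists_box_codes
    (hskel : ∀ ⦃α β : Iio τ.ord⦄ (h : α ≤ β), IsSkeletal (S.bond h))
    (hlim : S.IsAlmostContinuous) {O : ∀ α, ℕ → Set (S.space α)}
    (hO₀ : ∀ α : Iio τ.ord, α.1 = 0 → TopologicalSpace.IsTopologicalBasis (range (O α)))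
    (hOs : ∀ (α β : Iio τ.ord) (h : α ≤ β), β.1 = Order.succ α.1 → IsBaseOver (S.bond h) (O β))
    (α : Iio τ.ord) :
    ∀ U : Set (S.space α), IsOpen U → U.Nonempty →
      ∃ (s : Finset (Iio τ.ord)) (t₀ : Iio τ.ord → ℕ), (∀ i ∈ s, i ≤ α) ∧
        ∀ t : Iio τ.ord → ℕ, (∀ i ∈ s, t i = t₀ i) → S.Codes O t α U := by
  classical
  induction α using WellFoundedLT.induction with
  | ind α IH =>
  rintro U hU ⟨y, hy⟩
  rcases Ordinal.zero_or_succ_or_isSuccLimit α.1 with h0 | ⟨d, hd⟩ | hl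
  · obtain ⟨_, ⟨n, rfl⟩, hyn, hnU⟩ := (hO₀ α h0).exists_subset_of_mem_open hy hU
    refine ⟨{α}, fun _ => n, by simp, fun t ht => ?_⟩
    obtain rfl : t α = n := ht α (Finset.mem_singleton_self α)
    exact .zero α U h0 ⟨y, hyn⟩ hnU
  · have hdα : d < α.1 := hd ▸ Order.lt_succ d
    let δ : Iio τ.ord := ⟨d, hdα.trans α.2⟩
    have hδ : δ < α := hdα
    have hs : α.1 = Order.succ δ.1 := hd.symm
    obtain ⟨hOo, hOb⟩ := hOs δ α hδ.le hs
    obtain ⟨n, A, hA, hyA, hyn, hsub⟩ := hOb U hU y hy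
    obtain ⟨s, t₀, hsδ, hc⟩ := IH δ hδ _ (hA.inter isOpen_interior)
      ((hskel hδ.le).nonempty_inter_interior hA (hOo n) ⟨y, hyA, hyn⟩)
    refine ⟨insert α s, Function.update t₀ α n, ?_, fun t ht => ?_⟩
    · intro i hi
      rcases Finset.mem_insert.1 hi with rfl | hi
      exacts [le_rfl, (hsδ i hi).trans hδ.le]
    · obtain rfl : t α = n := by simpa using ht α (Finset.mem_insert_self α s)
      refine .succ δ α hδ.le hs U A _ hA (hA.inter isOpen_interior) inter_subset_left
        (inter_subset_right.trans interior_subset) hsub (hc t fun i hi => ?_)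
      -- The bound `i ≤ δ` on the support ensures that changing the value at `α` leaves the earlier
      -- box intact.
      rw [ht i (Finset.mem_insert_of_mem hi),
        Function.update_of_ne ((hsδ i hi).trans_lt hδ).ne]
  · have h0α : (0 : Ordinal) < α.1 := hl.bot_lt
    have : Nonempty (Iio α) := ⟨⟨⟨0, h0α.trans α.2⟩, h0α⟩⟩
    obtain ⟨δ, V, hV, hyV, hVU⟩ := exists_preimage_subset_of_isInducing
      (F := fun δ : Iio α => S.space δ.1) (p := fun _ _ h => S.bond h)
      (fun _ _ h => S.continuous_bond h) (hlim α hl).isInducing hU hy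
    obtain ⟨s, t₀, hsδ, hc⟩ := IH δ.1 δ.2 V hV ⟨_, hyV⟩
    exact ⟨s, t₀, fun i hi => (hsδ i hi).trans (le_of_lt δ.2),
      fun t ht => .limit δ.1 α δ.2 hl U V hV (fun z hz => hVU z hz) (hc t ht)⟩

theorem HasMetrizableSteps.exists_families (h : S.HasMetrizableSteps) :
    ∃ O : ∀ α, ℕ → Set (S.space α),
      (∀ α : Iio τ.ord, α.1 = 0 → TopologicalSpace.IsTopologicalBasis (range (O α))) ∧
      ∀ (α β : Iio τ.ord) (h : α ≤ β), β.1 = Order.succ α.1 → IsBaseOver (S.bond h) (O β) := by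
  obtain ⟨⟨h0, _, _⟩, hk⟩ := h
  have key : ∀ β : Iio τ.ord, ∃ B : ℕ → Set (S.space β),
      (β.1 = 0 → TopologicalSpace.IsTopologicalBasis (range B)) ∧
      ∀ (α : Iio τ.ord) (h : α ≤ β), β.1 = Order.succ α.1 → IsBaseOver (S.bond h) B := by
    intro β
    by_cases hβ : β.1 = 0
    · obtain rfl : β = ⟨0, h0⟩ := Subtype.ext hβ
      have := secondCountableTopology_of_separable_metrizable (S.space ⟨0, h0⟩)
      obtain ⟨B, hB⟩ := exists_seq_isTopologicalBasis (S.space ⟨0, h0⟩)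
      exact ⟨B, fun _ => hB, fun α _ hs => absurd hs.symm (Order.succ_ne_bot α.1)⟩
    · by_cases hs : ∃ α : Iio τ.ord, ∃ _ : α ≤ β, β.1 = Order.succ α.1
      · obtain ⟨α, h, hs⟩ := hs
        obtain ⟨B, hB⟩ := (hk α β h hs).exists_isBaseOver
        refine ⟨B, fun h => absurd h hβ, fun α' h' hs' => ?_⟩
        obtain rfl : α = α' := Subtype.ext (Order.succ_injective (hs.symm.trans hs'))
        exact hB
      -- At a limit index nothing is required of the family.
      · exact ⟨fun _ => ∅, fun h => absurd h hβ, fun α h hs' => absurd ⟨α, h, hs'⟩ hs⟩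
  choose O h₀ hs using key
  exact ⟨O, h₀, fun α β => hs β α⟩

end WellOrderedInverseSystem

/-! ### Cellularity of the embedded space -/

theorem IsSkeletallyDugundji.hasCountableCellularity {X : Type u} [TopologicalSpace X]
    (hD : IsSkeletallyDugundji.{u, v, w} X) : HasCountableCellularity X := by
  obtain ⟨τ, S, hbond, hsteps, hlim, ⟨e, he, hsurj⟩, -⟩ := hD
  obtain ⟨O, hO₀, hOs⟩ := hsteps.exists_families
  have : Nonempty (Iio τ.ord) := ⟨⟨0, hsteps.1.1⟩⟩
  intro 𝒰 h𝒰 hdisj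
  have hbase : ∀ G : 𝒰, ∃ (α : Iio τ.ord) (U : Set (S.space α)), IsOpen U ∧ U.Nonempty ∧
      ∀ z, (e z).1 α ∈ U → z ∈ G.1 := by
    intro G
    obtain ⟨hG, y, hy⟩ := h𝒰 G.1 G.2
    obtain ⟨α, U, hU, hyU, hUG⟩ :=
      exists_preimage_subset_of_isInducing S.continuous_bond he.isInducing hG hy
    exact ⟨α, U, hU, ⟨_, hyU⟩, hUG⟩
  choose α U hU hne hUG using hbase
  refine countable_coe_iff.1 (countable_of_disjoint_boxes
    (fun G : 𝒰 => {t : Iio τ.ord → ℕ | S.Codes O t (α G) (U G)}) (fun G => ?_) fun G H hGH => ?_)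
  · obtain ⟨s, t₀, -, h⟩ := WellOrderedInverseSystem.exists_box_codes (fun _ _ h => (hbond h).2)
      hlim hO₀ hOs (α G) (U G) (hU G) (hne G)
    exact ⟨s, t₀, h⟩
  · refine disjoint_left.2 fun t ht ht' => ?_
    obtain ⟨x, hx, hx'⟩ := WellOrderedInverseSystem.Codes.exists_mem (fun _ _ h => (hbond h).1)
      (max (α G) (α H)) (α G) (α H) (le_max_left _ _) (le_max_right _ _) (U G) (U H)
      (hU G) (hU H) ht ht'
    -- `X` projects onto every space of the system, so the common point comes from `X`.
    obtain ⟨z, rfl⟩ := hsurj _ x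
    simp only [WellOrderedInverseSystem.proj] at hx hx'
    rw [(e z).2] at hx hx'
    exact (hdisj G.2 H.2 (Subtype.coe_injective.ne hGH)).le_bot ⟨hUG G z hx, hUG H z hx'⟩

theorem lemma2p5 (X : Type u) [TopologicalSpace X] [T35Space X]
    (hD : IsSkeletallyDugundji.{u, v, w} X) (hP : IsPSpace X) : DiscreteTopology X :=
  hP.discreteTopology hD.hasCountableCellularity
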